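/- A pseudo-BCI-algebra is an algebra $(A,\rightarrow,\rightsquigarrow,1)$ of type $(2,2,0)$ satisfying the identities $$(x\rightarrow y)\rightsquigarrow((y\rightarrow z)\rightsquigarrow(x\rightarrow z))=1,\qquad (x\rightsquigarrow y)\rightarrow((y\rightsquigarrow z)\rightarrow(x\rightsquigarrow z))=1,$$ $$1\rightarrow x=x,\qquad 1\rightsquigarrow x=x,$$ and the quasi-identity $x\rightarrow y=1\ \&\ y\rightarrow x=1\ \Rightarrow\ x=y$. A pseudo-BCK-algebra is a pseudo-BCI-algebra that also satisfies $x\rightarrow 1=1$. Let $\mathsf{PBCI}$ and $\mathsf{PBCK}$ denote the quasivarieties of all pseudo-BCI-algebras and of all pseudo-BCK-algebras, respectively. A quasivariety $\mathsf Q$ whose language has a constant $1$ is called $1$-conservative if $\mathsf Q$ and the variety $\mathrm{HSP}(\mathsf Q)$ that it generates (the homomorphic images of subalgebras of direct products of members of $\mathsf Q$) satisfy the same quasi-identities of the form $$\bigwedge_{i=1}^{n} s_i(x_1,\dots,x_k)=1\ \Rightarrow\ t(x_1,\dots,x_k)=1,$$ where $s_1,\dots,s_n,t$ are terms in the language of $\mathsf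 Q$. Corollary. The quasivarieties $\mathsf{PBCK}$ and $\mathsf{PBCI}$ are $1$-conservative. -/

import Mathlib

universe u

open FirstOrder

namespace PseudoBCI

open FirstOrder.Language

section UniversalAlgebra

/-- A class of `L`-structures (with carriers in `Type u`). -/
abbrev AlgClass (L : FirstOrder.Language.{0, 0}) : Type (u + 1) := ∀ (_A : Type u) [L.Structure _A], Prop

/-- The direct product of a family of `L`-structures, with coordinatewise operations. -/
instance piStructure {L : FirstOrder.Language.{0, 0}} {I : Type u} (B : I → Type u)
    [∀ i, L.Structure (B i)] : L.Structure (∀ i, B i) where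
  funMap f x := fun i => Structure.funMap f (fun j => x j i)
  RelMap r x := ∀ i, Structure.RelMap r (fun j => x j i)

/-- `H(K)`: homomorphic images of members of `K`. -/
def ClassH {L : FirstOrder.Language.{0, 0}} (K : AlgClass.{u} L) : AlgClass.{u} L := fun A _ =>
  ∃ (B : Type u) (_ : L.Structure B), K B ∧ ∃ f : B →[L] A, Function.Surjective f

/-- `S(K)`: algebras isomorphic to subalgebras of members of `K`. -/
def ClassS {L : FirstOrder.Language.{0, 0}} (K : AlgClass.{u} L) : AlgClass.{u} L := fun A _ =>
  ∃ (B : Type u) (_ : L.Structure B), K B ∧ Nonempty (A ↪[L] B)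

/-- `P(K)`: algebras isomorphic to direct products of families of members of `K`. -/
def ClassP {L : FirstOrder.Language.{0, 0}} (K : AlgClass.{u} L) : AlgClass.{u} L := fun A _ =>
  ∃ (I : Type u) (B : I → Type u) (_ : ∀ i, L.Structure (B i)),
    (∀ i, K (B i)) ∧ Nonempty (A ≃[L] ∀ i, B i)

/-- The variety `HSP(K)` generated by `K`. -/
def ClassHSP {L : FirstOrder.Language.{0, 0}} (K : AlgClass.{u} L) : AlgClass.{u} L :=
  ClassH (ClassS (ClassP K))

/-- The algebra `A` satisfies the quasi-identity
`s 0 = e ∧ … ∧ s (n - 1) = e → t = e` in the variables `x_0, …, x_{k-1}`,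
where `e` is a constant symbol. -/
def SatisfiesPointedQuasiIdentity {L : FirstOrder.Language.{0, 0}} (e : L.Constants) {k n : ℕ}
    (s : Fin n → L.Term (Fin k)) (t : L.Term (Fin k)) (A : Type u) [L.Structure A] : Prop :=
  ∀ v : Fin k → A, (∀ i, (s i).realize v = (e : A)) → t.realize v = (e : A)

/-- `K` is `e`-conservative for a constant symbol `e`: the class `K` and the variety `HSP(K)`
satisfy the same quasi-identities of the form `⋀ s_i = e ⇒ t = e`. -/
def Conservative {L : FirstOrder.Language.{0, 0}} (e : L.Constants) (K : AlgClass.{u} L) : Prop :=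
  ∀ (k n : ℕ) (s : Fin n → L.Term (Fin k)) (t : L.Term (Fin k)),
    (∀ (A : Type u) [L.Structure A], K A → SatisfiesPointedQuasiIdentity e s t A) ↔
      (∀ (A : Type u) [L.Structure A], ClassHSP K A → SatisfiesPointedQuasiIdentity e s t A)

end UniversalAlgebra

/-- The operation symbols `→`, `⇝` (binary) and `1` (constant). -/
inductive ArrowFunc : ℕ → Type
  | imp : ArrowFunc 2
  | rimp : ArrowFunc 2
  | one : ArrowFunc 0

/-- The algebraic language `{→, ⇝, 1}` of type `(2, 2, 0)`. -/
def arrowLang : FirstOrder.Language.{0, 0} where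
  Functions := ArrowFunc
  Relations := fun _ => Empty

instance : arrowLang.IsAlgebraic := fun _ => inferInstanceAs (IsEmpty Empty)

/-- The constant symbol `1`. -/
abbrev oneSymb : arrowLang.Constants := ArrowFunc.one

/-- The operation `x → y` of an algebra of type `(2, 2, 0)`. -/
def imp {A : Type u} [arrowLang.Structure A] (x y : A) : A :=
  Structure.funMap (L := arrowLang) (ArrowFunc.imp : arrowLang.Functions 2) ![x, y]

/-- The operation `x ⇝ y` of an algebra of type `(2, 2, 0)`. -/
def rimp {A : Type u} [arrowLang.Structure A] (x y : A) : A :=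
  Structure.funMap (L := arrowLang) (ArrowFunc.rimp : arrowLang.Functions 2) ![x, y]

/-- The distinguished element `1` of an algebra of type `(2, 2, 0)`. -/
def one (A : Type u) [arrowLang.Structure A] : A := (oneSymb : A)

/-- Pseudo-BCI-algebras. -/
structure IsPseudoBCI (A : Type u) [arrowLang.Structure A] : Prop where
  imp_trans : ∀ x y z : A, rimp (imp x y) (rimp (imp y z) (imp x z)) = one A
  rimp_trans : ∀ x y z : A, imp (rimp x y) (imp (rimp y z) (rimp x z)) = one A
  one_imp : ∀ x : A, imp (one A) x = x
  one_rimp : ∀ x : A, rimp (one A) x = x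
  antisymm : ∀ x y : A, imp x y = one A → imp y x = one A → x = y

/-- Pseudo-BCK-algebras: pseudo-BCI-algebras satisfying `x → 1 = 1`. -/
structure IsPseudoBCK (A : Type u) [arrowLang.Structure A] : Prop extends IsPseudoBCI A where
  imp_one : ∀ x : A, imp x (one A) = one A

/-- The quasivariety of pseudo-BCI-algebras. -/
def PBCI : AlgClass.{u} arrowLang := fun A _ => IsPseudoBCI A

/-- The quasivariety of pseudo-BCK-algebras. -/
def PBCK : AlgClass.{u} arrowLang := fun A _ => IsPseudoBCK A

end PseudoBCI

namespace PseudoBCI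

open FirstOrder.Language

section Operations

variable {A B : Type u} [arrowLang.Structure A] [arrowLang.Structure B]

/-! Every identity passes to `HSP`, so a member of the generated variety can only fail the
antisymmetry quasi-identity. The remaining identities already make `x → y = 1` a preorder whose
symmetric part is a congruence, and the quotient is a pseudo-BCI-algebra. The class of `1` is just
`{1}`, since `1 → x = x`; hence a quasi-identity between equations `… = 1` that holds in the
quotient holds in the algebra (`toQuot_eq_one_iff`). For `PBCK`, the identity `x → 1 = 1` also
survives in `HSP` and in the quotient. -/

theorem map_imp (f : A →[arrowLang] B) (x y : A) : f (imp x y) = imp (f x) (f y) := by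
  refine (f.map_fun (ArrowFunc.imp : arrowLang.Functions 2) ![x, y]).trans (congrArg _ ?_)
  ext i
  fin_cases i <;> rfl

theorem map_rimp (f : A →[arrowLang] B) (x y : A) : f (rimp x y) = rimp (f x) (f y) := by
  refine (f.map_fun (ArrowFunc.rimp : arrowLang.Functions 2) ![x, y]).trans (congrArg _ ?_)
  ext i
  fin_cases i <;> rfl

theorem map_one (f : A →[arrowLang] B) : f (one A) = one B :=
  f.map_constants oneSymb

/-- The projection of a direct product onto a factor. -/
def piProj {I : Type u} (C : I → Type u) [∀ i, arrowLang.Structure (C i)] (i : I) :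
    (∀ i, C i) →[arrowLang] C i where
  toFun x := x i
  map_fun' _ _ := rfl
  map_rel' r _ _ := isEmptyElim (α := Empty) r

end Operations

/-- The identities in the definition of pseudo-BCI-algebras, without the quasi-identity. -/
structure SatisfiesBCIIdentities (A : Type u) [arrowLang.Structure A] : Prop where
  imp_trans : ∀ x y z : A, rimp (imp x y) (rimp (imp y z) (imp x z)) = one A
  rimp_trans : ∀ x y z : A, imp (rimp x y) (imp (rimp y z) (rimp x z)) = one A
  one_imp : ∀ x : A, imp (one A) x = x
  one_rimp : ∀ x : A, rimp (one A) x = x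

section Preservation

theorem IsPseudoBCI.satisfiesBCIIdentities {A : Type u} [arrowLang.Structure A]
    (h : IsPseudoBCI A) : SatisfiesBCIIdentities A :=
  ⟨h.imp_trans, h.rimp_trans, h.one_imp, h.one_rimp⟩

variable {A B : Type u} [arrowLang.Structure A] [arrowLang.Structure B]

theorem SatisfiesBCIIdentities.of_surjective (h : SatisfiesBCIIdentities B)
    (f : B →[arrowLang] A) (hf : Function.Surjective f) : SatisfiesBCIIdentities A where
  imp_trans := by
    refine hf.forall₃.2 fun x y z => ?_
    simp only [← map_imp, ← map_rimp, ← map_one f, h.imp_trans]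
  rimp_trans := by
    refine hf.forall₃.2 fun x y z => ?_
    simp only [← map_imp, ← map_rimp, ← map_one f, h.rimp_trans]
  one_imp := by
    refine hf.forall.2 fun x => ?_
    rw [← map_one f, ← map_imp, h.one_imp]
  one_rimp := by
    refine hf.forall.2 fun x => ?_
    rw [← map_one f, ← map_rimp, h.one_rimp]

/-- The identities hold in an algebra with a point-separating family of homomorphisms to algebras
in which they hold. -/
theorem SatisfiesBCIIdentities.of_separating {I : Type u} {C : I → Type u}
    [∀ i, arrowLang.Structure (C i)] (h : ∀ i, SatisfiesBCIIdentities (C i))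
    (f : ∀ i, A →[arrowLang] C i) (hf : ∀ x y, (∀ i, f i x = f i y) → x = y) :
    SatisfiesBCIIdentities A where
  imp_trans x y z := hf _ _ fun i => by simp only [map_imp, map_rimp, map_one, (h i).imp_trans]
  rimp_trans x y z := hf _ _ fun i => by simp only [map_imp, map_rimp, map_one, (h i).rimp_trans]
  one_imp x := hf _ _ fun i => by rw [map_imp, map_one, (h i).one_imp]
  one_rimp x := hf _ _ fun i => by rw [map_rimp, map_one, (h i).one_rimp]

/-- A member of `HSP(K)` is a homomorphic image of an algebra with a point-separating family of
homomorphisms to members of `K`. -/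
theorem ClassHSP.exists_separating {K : AlgClass.{u} arrowLang} (h : ClassHSP K A) :
    ∃ (B : Type u) (_ : arrowLang.Structure B) (g : B →[arrowLang] A) (I : Type u)
      (C : I → Type u) (_ : ∀ i, arrowLang.Structure (C i)) (f : ∀ i, B →[arrowLang] C i),
      Function.Surjective g ∧ (∀ i, K (C i)) ∧ ∀ x y, (∀ i, f i x = f i y) → x = y := by
  obtain ⟨B, _, ⟨D, _, ⟨I, C, _, hC, ⟨e⟩⟩, ⟨j⟩⟩, g, hg⟩ := h
  refine ⟨B, _, g, I, C, _, fun i => ((piProj C i).comp e.toHom).comp j.toHom, hg, hC, ?_⟩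
  intro x y hxy
  exact j.injective (e.injective (funext hxy))

theorem ClassHSP.satisfiesBCIIdentities {K : AlgClass.{u} arrowLang} (h : ClassHSP K A)
    (hK : ∀ (C : Type u) [arrowLang.Structure C], K C → IsPseudoBCI C) :
    SatisfiesBCIIdentities A := by
  obtain ⟨B, _, g, I, C, _, f, hg, hC, hf⟩ := h.exists_separating
  exact (SatisfiesBCIIdentities.of_separating
    (fun i => (hK _ (hC i)).satisfiesBCIIdentities) f hf).of_surjective g hg

theorem ClassHSP.imp_one (h : ClassHSP PBCK A) (x : A) : imp x (one A) = one A := by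
  obtain ⟨B, _, g, I, C, _, f, hg, hC, hf⟩ := h.exists_separating
  obtain ⟨x, rfl⟩ := hg x
  have hx : imp x (one B) = one B := hf _ _ fun i => by
    rw [map_imp, map_one, (hC i).imp_one]
  rw [← map_one g, ← map_imp, hx]

end Preservation

theorem classHSP_of_mem {L : FirstOrder.Language.{0, 0}} {K : AlgClass.{u} L} {A : Type u}
    [L.Structure A] (h : K A) : ClassHSP K A := by
  -- `A` embeds in its own power over a one-point index set.
  refine ⟨A, _, ⟨∀ _ : PUnit.{u + 1}, A, inferInstance,
    ⟨PUnit, fun _ => A, fun _ => inferInstance, fun _ => h, ⟨.refl L _⟩⟩, ⟨?_⟩⟩, .id L A,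
    Function.surjective_id⟩
  exact
    { toFun := fun x _ => x
      inj' := fun x y hxy => congrFun hxy PUnit.unit
      map_fun' := fun _ _ => rfl
      map_rel' := fun _ _ => ⟨fun H => H PUnit.unit, fun H _ => H⟩ }

namespace SatisfiesBCIIdentities

variable {A : Type u} [arrowLang.Structure A] {x y z : A}

theorem imp_self (h : SatisfiesBCIIdentities A) (x : A) : imp x x = one A := by
  simpa only [h.one_imp, h.one_rimp] using h.rimp_trans (one A) (one A) x

/-- With `imp_eq_one`: both arrows induce the same preorder, so one congruence serves both. -/
theorem rimp_eq_one (h : SatisfiesBCIIdentities A) (hxy : imp x y = one A) :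
    rimp x y = one A := by
  simpa only [h.one_imp, h.one_rimp, hxy] using h.imp_trans (one A) x y

theorem imp_eq_one (h : SatisfiesBCIIdentities A) (hxy : rimp x y = one A) :
    imp x y = one A := by
  simpa only [h.one_imp, h.one_rimp, hxy] using h.rimp_trans (one A) x y

theorem imp_eq_one_trans (h : SatisfiesBCIIdentities A) (hxy : imp x y = one A)
    (hyz : imp y z = one A) : imp x z = one A := by
  simpa only [h.one_rimp, hxy, hyz] using h.imp_trans x y z

theorem imp_antitone_left (h : SatisfiesBCIIdentities A) (z : A) (hxy : imp x y = one A) :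
    imp (imp y z) (imp x z) = one A := by
  apply h.imp_eq_one
  simpa only [h.one_rimp, hxy] using h.imp_trans x y z

theorem rimp_antitone_left (h : SatisfiesBCIIdentities A) (z : A) (hxy : imp x y = one A) :
    imp (rimp y z) (rimp x z) = one A := by
  simpa only [h.one_imp, h.rimp_eq_one hxy] using h.rimp_trans x y z

/-- Writing `≤` for the preorder, `y ≤ (y ⇝ z) → z ≤ x → z`, the second step by antitonicity. -/
theorem le_imp_of_le_rimp (h : SatisfiesBCIIdentities A) (hxyz : imp x (rimp y z) = one A) :
    imp y (imp x z) = one A := by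
  refine h.imp_eq_one_trans ?_ (h.imp_antitone_left z hxyz)
  simpa only [h.one_rimp] using h.rimp_trans (one A) y z

theorem le_rimp_of_le_imp (h : SatisfiesBCIIdentities A) (hxyz : imp x (imp y z) = one A) :
    imp y (rimp x z) = one A := by
  refine h.imp_eq_one_trans ?_ (h.rimp_antitone_left z hxyz)
  apply h.imp_eq_one
  simpa only [h.one_imp] using h.imp_trans (one A) y z

/-- Exchanging the premises of the transitivity identity gives `x → y ≤ (z → x) → (z → y)`. -/
theorem imp_monotone_right (h : SatisfiesBCIIdentities A) (z : A) (hxy : imp x y = one A) :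
    imp (imp z x) (imp z y) = one A := by
  simpa only [h.one_imp, hxy] using h.le_imp_of_le_rimp (h.imp_eq_one (h.imp_trans z x y))

theorem rimp_monotone_right (h : SatisfiesBCIIdentities A) (z : A) (hxy : imp x y = one A) :
    imp (rimp z x) (rimp z y) = one A := by
  apply h.imp_eq_one
  simpa only [h.one_rimp, h.rimp_eq_one hxy] using
    h.rimp_eq_one (h.le_rimp_of_le_imp (h.rimp_trans z x y))

/-- The symmetric part of the preorder `x → y = 1`. -/
def setoid (h : SatisfiesBCIIdentities A) : Setoid A where
  r x y := imp x y = one A ∧ imp y x = one A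
  iseqv :=
    { refl := fun x => ⟨h.imp_self x, h.imp_self x⟩
      symm := And.symm
      trans := fun hxy hyz =>
        ⟨h.imp_eq_one_trans hxy.1 hyz.1, h.imp_eq_one_trans hyz.2 hxy.2⟩ }

/-- The quotient by the symmetric part of the preorder `x → y = 1`. -/
def Quot (h : SatisfiesBCIIdentities A) : Type u := Quotient h.setoid

instance (h : SatisfiesBCIIdentities A) : arrowLang.Structure h.Quot where
  funMap {n} f := match n, f with
    | _, ArrowFunc.imp => fun v => Quotient.map₂ (sa := h.setoid) (sb := h.setoid)
        (sc := h.setoid) imp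
        (fun _ b hab c d hcd =>
          -- One argument at a time: `a → c ≤ b → c ≤ b → d`, and back.
          ⟨h.imp_eq_one_trans (h.imp_antitone_left c hab.2) (h.imp_monotone_right b hcd.1),
            h.imp_eq_one_trans (h.imp_antitone_left d hab.1) (h.imp_monotone_right _ hcd.2)⟩)
        (v 0) (v 1)
    | _, ArrowFunc.rimp => fun v => Quotient.map₂ (sa := h.setoid) (sb := h.setoid)
        (sc := h.setoid) rimp
        (fun _ b hab c d hcd =>
          ⟨h.imp_eq_one_trans (h.rimp_antitone_left c hab.2) (h.rimp_monotone_right b hcd.1),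
            h.imp_eq_one_trans (h.rimp_antitone_left d hab.1) (h.rimp_monotone_right _ hcd.2)⟩)
        (v 0) (v 1)
    | _, ArrowFunc.one => fun _ => Quotient.mk h.setoid (one A)
  RelMap r _ := isEmptyElim (α := Empty) r

/-- The quotient homomorphism. -/
def toQuot (h : SatisfiesBCIIdentities A) : A →[arrowLang] h.Quot where
  toFun := Quotient.mk h.setoid
  map_fun' {n} f v := match n, f with
    | _, ArrowFunc.imp => by
        have hv : v = ![v 0, v 1] := by ext i; fin_cases i <;> rfl
        rw [hv]
        rfl
    | _, ArrowFunc.rimp => by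
        have hv : v = ![v 0, v 1] := by ext i; fin_cases i <;> rfl
        rw [hv]
        rfl
    | _, ArrowFunc.one => by
        have hv : v = ![] := Subsingleton.elim _ _
        rw [hv]
        rfl
  map_rel' r _ _ := isEmptyElim (α := Empty) r

theorem toQuot_surjective (h : SatisfiesBCIIdentities A) : Function.Surjective h.toQuot :=
  Quotient.mk_surjective

theorem toQuot_eq_toQuot_iff (h : SatisfiesBCIIdentities A) :
    h.toQuot x = h.toQuot y ↔ imp x y = one A ∧ imp y x = one A :=
  Quotient.eq (r := h.setoid)

/-- If `x` is congruent to `1`, then `x = 1 → x = 1`. -/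
theorem toQuot_eq_one_iff (h : SatisfiesBCIIdentities A) : h.toQuot x = one h.Quot ↔ x = one A := by
  refine ⟨fun hx => ?_, fun hx => by rw [hx, map_one]⟩
  rw [← map_one h.toQuot, toQuot_eq_toQuot_iff, h.one_imp] at hx
  exact hx.2

theorem isPseudoBCI_quot (h : SatisfiesBCIIdentities A) : IsPseudoBCI h.Quot where
  imp_trans := (h.of_surjective h.toQuot h.toQuot_surjective).imp_trans
  rimp_trans := (h.of_surjective h.toQuot h.toQuot_surjective).rimp_trans
  one_imp := (h.of_surjective h.toQuot h.toQuot_surjective).one_imp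
  one_rimp := (h.of_surjective h.toQuot h.toQuot_surjective).one_rimp
  antisymm := by
    refine h.toQuot_surjective.forall₂.2 fun x y hxy hyx => ?_
    -- As only `1` maps to `1`, both inequalities already hold in `A`.
    rw [← map_imp, toQuot_eq_one_iff] at hxy hyx
    exact h.toQuot_eq_toQuot_iff.2 ⟨hxy, hyx⟩

theorem satisfiesPointedQuasiIdentity_of_quot (h : SatisfiesBCIIdentities A) {k n : ℕ}
    {s : Fin n → arrowLang.Term (Fin k)} {t : arrowLang.Term (Fin k)}
    (hq : SatisfiesPointedQuasiIdentity oneSymb s t h.Quot) :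
    SatisfiesPointedQuasiIdentity oneSymb s t A := by
  intro v hv
  have key := hq (h.toQuot ∘ v) fun i => by
    rw [HomClass.realize_term, hv i]
    exact map_one h.toQuot
  rw [HomClass.realize_term] at key
  exact h.toQuot_eq_one_iff.1 key

end SatisfiesBCIIdentities

/-- A class of pseudo-BCI-algebras is `1`-conservative if it contains the canonical pseudo-BCI
quotient of every algebra of the variety that it generates. -/
theorem conservative_of_quot_mem {K : AlgClass.{u} arrowLang}
    (hK : ∀ (A : Type u) [arrowLang.Structure A], K A → IsPseudoBCI A)
    (hq : ∀ (A : Type u) [arrowLang.Structure A], ClassHSP K A →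
      ∀ h : SatisfiesBCIIdentities A, K h.Quot) :
    Conservative oneSymb K := by
  intro k n s t
  refine ⟨fun H A _ hA => ?_, fun H A _ hA => H A (classHSP_of_mem hA)⟩
  have h := hA.satisfiesBCIIdentities hK
  exact h.satisfiesPointedQuasiIdentity_of_quot (H _ (hq A hA h))

end PseudoBCI

theorem mainTheorem8 :
    PseudoBCI.Conservative.{u} PseudoBCI.oneSymb PseudoBCI.PBCK ∧
      PseudoBCI.Conservative.{u} PseudoBCI.oneSymb PseudoBCI.PBCI := by
  refine ⟨PseudoBCI.conservative_of_quot_mem (fun A _ h => h.toIsPseudoBCI) fun A _ hA h => ?_,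
    PseudoBCI.conservative_of_quot_mem (fun A _ h => h) fun A _ _ h => h.isPseudoBCI_quot⟩
  -- `x → 1 = 1` is an identity, so it passes from `A` to its quotient.
  refine ⟨h.isPseudoBCI_quot, h.toQuot_surjective.forall.2 fun x => ?_⟩
  rw [← PseudoBCI.map_one h.toQuot, ← PseudoBCI.map_imp, hA.imp_one]
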